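/- Let $H(\mathbb C)$ be the space of entire functions with the compact-open topology (a Fréchet space), and define $P:H(\mathbb C)\to H(\mathbb C)$ by $$P(f)(z)=f(0)\cdot f(z+1).$$ Then $P$ is a continuous $2$-homogeneous polynomial, i.e. there is a continuous bilinear map $L:H(\mathbb C)\times H(\mathbb C)\to H(\mathbb C)$ with $P(f)=L(f,f)$ for all $f$, and $P$ is 1. mixing: for all nonempty open sets $U,V\subseteq H(\mathbb C)$ there is $n_0$ such that $P^n(U)\cap V\neq\emptyset$ for every $n\ge n_0$; 2. chaotic: $P$ is hypercyclic, i.e. some $f$ has a dense orbit $\{P^n(f):n\in\mathbb N\}$, and the set of periodic points of $P$ (those $f$ with $P^n(f)=f$ for some $n\ge 1$) is dense in $H(\mathbb C)$; 3. frequently hypercyclic: there is $f\in H(\mathbb C)$ such that for every nonempty open set $U\subseteq H(\mathbb C)$ the set $A=\{n\in\mathbb N: P^n(f)\in U\}$ has positive lower density, i.e. $\liminf_{n\to\infty}\frac{\#\{x\in A:\,0\le x\le n\}}{n}>0$. -/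

import Mathlib

open Filter Topology

noncomputable section

/-- The space `H(ℂ)` of entire functions, as a linear subspace of `C(ℂ, ℂ)`. It carries the
subspace topology of the compact-open topology of `C(ℂ, ℂ)`, which is the topology of uniform
convergence on compact sets. -/
def EntireFunctions : Submodule ℂ C(ℂ, ℂ) where
  carrier := {f | Differentiable ℂ f}
  zero_mem' := differentiable_const (0 : ℂ)
  add_mem' hf hg := Differentiable.add hf hg
  smul_mem' c _ hf := Differentiable.const_smul hf c

/-- `X` is a topological vector space. The map `P : X → X` is a (continuous) `d`-homogeneous
polynomial: the restriction to the diagonal of a continuous `d`-linear map `L : X ^ d → X`. -/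
def IsHomogeneousPolynomial {X : Type*} [TopologicalSpace X] [AddCommGroup X] [Module ℂ X]
    (d : ℕ) (P : X → X) : Prop :=
  ∃ L : ContinuousMultilinearMap ℂ (fun _ : Fin d => X) X, ∀ x, P x = L (fun _ => x)

/-- A self-map `T` of a topological space is mixing if for all nonempty open `U`, `V` the set
`T ^ n (U) ∩ V` is nonempty for all large enough `n`. -/
def IsMixing {X : Type*} [TopologicalSpace X] (T : X → X) : Prop :=
  ∀ U V : Set X, IsOpen U → U.Nonempty → IsOpen V → V.Nonempty →
    ∃ n₀ : ℕ, ∀ n ≥ n₀, ((T^[n] '' U) ∩ V).Nonempty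

/-- A self-map `T` is hypercyclic if some point has a dense orbit. -/
def IsHypercyclic {X : Type*} [TopologicalSpace X] (T : X → X) : Prop :=
  ∃ x : X, Dense (Set.range fun n : ℕ => T^[n] x)

/-- A self-map `T` is chaotic if it is hypercyclic and its periodic points are dense. -/
def IsChaotic {X : Type*} [TopologicalSpace X] (T : X → X) : Prop :=
  IsHypercyclic T ∧ Dense (Function.periodicPts T)

/-- `A ⊆ ℕ` has positive lower density: `liminf #{x ∈ A : 0 ≤ x ≤ n} / n > 0`. -/
def HasPositiveLowerDensity (A : Set ℕ) : Prop :=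
  0 < liminf (fun n : ℕ => ({x ∈ A | x ≤ n}.ncard : ℝ) / n) atTop

/-- A self-map `T` is frequently hypercyclic if there is a point `x` such that, for every
nonempty open `U`, the set of times at which the orbit of `x` visits `U` has positive lower
density. -/
def IsFrequentlyHypercyclic {X : Type*} [TopologicalSpace X] (T : X → X) : Prop :=
  ∃ x : X, ∀ U : Set X, IsOpen U → U.Nonempty →
    HasPositiveLowerDensity {n : ℕ | T^[n] x ∈ U}

/-- The map `P` on `H(ℂ)` given by `P(f)(z) = f(0) * f(z + 1)`. -/
def evalMulTranslate (f : EntireFunctions) : EntireFunctions :=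
  ⟨⟨fun z => f.1 0 * f.1 (z + 1), by fun_prop⟩, by
    have hf : Differentiable ℂ f.1 := f.2
    exact (hf.comp (differentiable_id.add_const (1 : ℂ))).const_mul (f.1 0)⟩

end

/-!
Iterating `P = evalMulTranslate` gives `P^n f (z) = c n * f (z + n)`, where `c 0 = 1` and
`c (n + 1) = c n ^ 2 * f n` (`orbitProduct`, `iterate_evalMulTranslate`). The factor `c n` depends
only on the values of `f` at the integers, and the proof constructs functions for which `c n = 1`
at prescribed times `n`, so that at these times `P^n` acts as the translation by `n`.

The building pieces are *blocks* (`IsBlock`): entire functions `ψ` that decay rapidly on horizontal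
strips, vanish at all integers far from `0`, and for which the values of `1 + ψ` at the integers
left of `0`, and at the integers `≥ 0`, each bring the factor from `1` back to `1`. The functions
`1 + ψ` are dense in the space of entire functions (`exists_block`). Indeed, there is an entire
function, built from `1 / Γ` and `exp (-z ^ 2)`, that decays rapidly, has no zeros on a given disc
and vanishes at all integers far away (`windowKernel`). A polynomial multiple of it approximates a
given function on the disc, and its values at two integers just outside the disc can be prescribed
freely (`exists_polynomial_peak`); these two values are chosen to satisfy the two conditions on the
factor.

Blocks translated to sufficiently separated centres can be added up (`exists_superposition`): with
`F z = 1 + ∑ i, ψ i (z - c i)` the factor is `1` at every centre `c i ≥ 0`, hence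
`P^(c i) F (z) = F (z + c i)`, which is close to `1 + ψ i z` on a disc because the other blocks are
small there. Two blocks at `0` and `n` give mixing, one block repeated with a large period gives a
periodic point, and blocks for all members of a countable basis, placed at separated sets of
positive lower density (`exists_separated_sets`), give a frequently hypercyclic function. Frequent
hypercyclicity implies hypercyclicity.
-/

open Filter Topology

/-! ### Products along an orbit -/

/-- The scalar accumulated by iterating `evalMulTranslate` along the values `a m, a (m + 1), …`:
it starts at `1` and each step squares it and multiplies by the next value. -/
def orbitProduct (a : ℤ → ℂ) (m : ℤ) : ℕ → ℂ
  | 0 => 1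
  | k + 1 => orbitProduct a m k ^ 2 * a (m + k)

theorem orbitProduct_add (a : ℤ → ℂ) (m : ℤ) (j k : ℕ) :
    orbitProduct a m (j + k) = orbitProduct a m j ^ 2 ^ k * orbitProduct a (m + j) k := by
  induction k with
  | zero => simp [orbitProduct]
  | succ k ih =>
    rw [← add_assoc, orbitProduct, ih, orbitProduct, pow_succ 2 k, pow_mul]
    push_cast
    rw [add_assoc]
    ring

theorem orbitProduct_congr {a b : ℤ → ℂ} {m m' : ℤ} {k : ℕ}
    (h : ∀ j : ℕ, j < k → a (m + j) = b (m' + j)) :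
    orbitProduct a m k = orbitProduct b m' k := by
  induction k with
  | zero => rfl
  | succ k ih =>
    rw [orbitProduct, orbitProduct, ih fun j hj => h j (by omega), h k (by omega)]

theorem orbitProduct_ne_zero {a : ℤ → ℂ} {m : ℤ} {k : ℕ}
    (h : ∀ j : ℕ, j < k → a (m + j) ≠ 0) : orbitProduct a m k ≠ 0 := by
  induction k with
  | zero => simp [orbitProduct]
  | succ k ih =>
    exact mul_ne_zero (pow_ne_zero _ (ih fun j hj => h j (by omega))) (h k (by omega))

theorem iterate_evalMulTranslate (f : EntireFunctions) (n : ℕ) (z : ℂ) :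
    (evalMulTranslate^[n] f).1 z = orbitProduct (fun j => f.1 j) 0 n * f.1 (z + n) := by
  induction n generalizing z with
  | zero => simp [orbitProduct]
  | succ n ih =>
    rw [Function.iterate_succ_apply']
    change (evalMulTranslate^[n] f).1 0 * (evalMulTranslate^[n] f).1 (z + 1) = _
    rw [ih, ih, orbitProduct]
    push_cast
    rw [show z + 1 + (n : ℂ) = z + (n + 1) by ring]
    simp only [zero_add]
    ring

/-! ### Entire functions decaying rapidly on horizontal strips -/

/-- `ψ` decays faster than every power of `‖z‖` on every horizontal strip. -/
def RapidDecay (ψ : ℂ → ℂ) : Prop :=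
  ∀ (S : ℝ) (k : ℕ), ∃ C, ∀ z : ℂ, |z.im| ≤ S → ‖z‖ ^ k * ‖ψ z‖ ≤ C

namespace RapidDecay

theorem add {ψ χ : ℂ → ℂ} (hψ : RapidDecay ψ) (hχ : RapidDecay χ) :
    RapidDecay fun z => ψ z + χ z := by
  intro S k
  obtain ⟨C, hC⟩ := hψ S k
  obtain ⟨D, hD⟩ := hχ S k
  refine ⟨C + D, fun z hz => ?_⟩
  calc ‖z‖ ^ k * ‖ψ z + χ z‖ ≤ ‖z‖ ^ k * (‖ψ z‖ + ‖χ z‖) := by gcongr; exact norm_add_le _ _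
    _ ≤ C + D := by rw [mul_add]; exact add_le_add (hC z hz) (hD z hz)

theorem const_mul {ψ : ℂ → ℂ} (hψ : RapidDecay ψ) (c : ℂ) : RapidDecay fun z => c * ψ z := by
  intro S k
  obtain ⟨C, hC⟩ := hψ S k
  refine ⟨‖c‖ * C, fun z hz => ?_⟩
  rw [norm_mul, mul_left_comm]
  exact mul_le_mul_of_nonneg_left (hC z hz) (norm_nonneg _)

theorem id_mul {ψ : ℂ → ℂ} (hψ : RapidDecay ψ) : RapidDecay fun z => z * ψ z := by
  intro S k
  obtain ⟨C, hC⟩ := hψ S (k + 1)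
  refine ⟨C, fun z hz => ?_⟩
  rw [norm_mul, ← mul_assoc, ← pow_succ]
  exact hC z hz

theorem eval_mul {ψ : ℂ → ℂ} (hψ : RapidDecay ψ) (p : Polynomial ℂ) :
    RapidDecay fun z => p.eval z * ψ z := by
  induction p using Polynomial.induction_on with
  | C a => simpa using hψ.const_mul a
  | add p q hp hq => simpa [add_mul] using hp.add hq
  | monomial n a ih =>
    have := ih.id_mul
    convert this using 2
    simp only [Polynomial.eval_mul, Polynomial.eval_C, Polynomial.eval_pow, Polynomial.eval_X]
    ring

theorem of_sub_mul {ψ : ℂ → ℂ} (hc : Continuous ψ) (a : ℂ)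
    (h : RapidDecay fun z => (z - a) * ψ z) : RapidDecay ψ := by
  intro S k
  obtain ⟨C, hC⟩ := h S k
  obtain ⟨D, hD⟩ := (isCompact_closedBall (0 : ℂ) (‖a‖ + 1)).exists_bound_of_continuousOn
    (f := fun z => (‖z‖ ^ k : ℝ) * ‖ψ z‖) (by fun_prop)
  refine ⟨max C D, fun z hz => ?_⟩
  rcases le_or_gt ‖z‖ (‖a‖ + 1) with h1 | h1
  · exact (le_abs_self _).trans ((hD z (by simpa using h1)).trans (le_max_right _ _))
  · have h2 : 1 ≤ ‖z - a‖ := by linarith [norm_sub_norm_le z a]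
    refine le_trans ?_ ((hC z hz).trans (le_max_left _ _))
    rw [norm_mul]
    gcongr
    exact le_mul_of_one_le_left (norm_nonneg _) h2

/-- On a horizontal strip the decay of `exp (-z ^ 2)` beats both `‖z‖ ^ k` and the sine. -/
theorem sin_mul_exp_neg_sq :
    RapidDecay fun z => Complex.sin (Real.pi * z) * Complex.exp (-z ^ 2) := by
  intro S k
  refine ⟨k.factorial * Real.exp (1 + S + Real.pi * S + S ^ 2), fun z hz => ?_⟩
  have hS : 0 ≤ S := (abs_nonneg _).trans hz
  have h1 : ‖z‖ ^ k ≤ k.factorial * Real.exp ‖z‖ := by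
    have := Real.pow_div_factorial_le_exp ‖z‖ (norm_nonneg _) k
    rwa [div_le_iff₀' (by positivity)] at this
  have h2 : ‖Complex.sin (Real.pi * z)‖ ≤ Real.exp (Real.pi * |z.im|) := by
    have hp : |Real.pi * z.im| = Real.pi * |z.im| := by
      rw [abs_mul, abs_of_pos Real.pi_pos]
    rw [Complex.sin, norm_div, norm_mul, Complex.norm_I, mul_one, Complex.norm_two,
      div_le_iff₀ two_pos]
    refine (norm_sub_le _ _).trans ?_
    rw [Complex.norm_exp, Complex.norm_exp, mul_two, ← hp]
    refine add_le_add (Real.exp_le_exp.2 ?_) (Real.exp_le_exp.2 ?_)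
    · simpa using le_abs_self (Real.pi * z.im)
    · simpa using neg_le_abs (Real.pi * z.im)
  have h3 : ‖Complex.exp (-z ^ 2)‖ = Real.exp (z.im ^ 2 - z.re ^ 2) := by
    rw [Complex.norm_exp]
    congr 1
    simp [sq]
  have h4 := Complex.norm_le_abs_re_add_abs_im z
  calc ‖z‖ ^ k * ‖Complex.sin (Real.pi * z) * Complex.exp (-z ^ 2)‖
      ≤ (k.factorial * Real.exp ‖z‖) *
        (Real.exp (Real.pi * |z.im|) * Real.exp (z.im ^ 2 - z.re ^ 2)) := by
        rw [norm_mul, h3]; gcongr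
    _ = k.factorial * Real.exp (‖z‖ + Real.pi * |z.im| + (z.im ^ 2 - z.re ^ 2)) := by
        rw [Real.exp_add, Real.exp_add]; ring
    _ ≤ _ := by
        refine mul_le_mul_of_nonneg_left (Real.exp_le_exp.2 ?_) (by positivity)
        have h5 : |z.re| ≤ 1 + z.re ^ 2 := by
          rw [← sq_abs z.re]; nlinarith [sq_nonneg (|z.re| - 1), abs_nonneg z.re]
        have h6 : z.im ^ 2 ≤ S ^ 2 := by
          rw [← sq_abs z.im]; gcongr
        have h7 : Real.pi * |z.im| ≤ Real.pi * S := by gcongr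
        linarith

/-- The form of rapid decay used for integer translates: on a bounded set, the translate by `d`
is at most `ε / d ^ 2` once `|d|` is large. -/
theorem translate_le {ψ : ℂ → ℂ} (hψ : RapidDecay ψ) (S : ℝ) {ε : ℝ} (hε : 0 < ε) :
    ∃ G : ℕ, ∀ d : ℤ, (G : ℤ) ≤ |d| → ∀ z : ℂ, ‖z‖ ≤ S → ‖ψ (z + d)‖ ≤ ε / (d : ℝ) ^ 2 := by
  obtain ⟨C, hC⟩ := hψ S 3
  obtain ⟨G, hG⟩ := exists_nat_ge (max 1 (max (2 * S) (8 * C / ε)))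
  refine ⟨G, fun d hd z hz => ?_⟩
  have hd' : (G : ℝ) ≤ |(d : ℝ)| := by exact_mod_cast hd
  have h1 : 1 ≤ |(d : ℝ)| := ((le_max_left _ _).trans hG).trans hd'
  have h2 : 2 * S ≤ |(d : ℝ)| :=
    (((le_max_left _ _).trans (le_max_right _ _)).trans hG).trans hd'
  have h3 : 8 * C / ε ≤ |(d : ℝ)| :=
    (((le_max_right _ _).trans (le_max_right _ _)).trans hG).trans hd'
  have hdn : ‖(d : ℂ)‖ = |(d : ℝ)| := by simp
  have h4 : |(d : ℝ)| / 2 ≤ ‖z + d‖ := by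
    have := norm_sub_le (z + d) z
    rw [add_sub_cancel_left, hdn] at this
    linarith
  have h5 := hC (z + d) (by
    simpa using (Complex.abs_im_le_norm z).trans hz)
  rw [div_le_iff₀ hε] at h3
  rw [← sq_abs, le_div_iff₀ (by positivity)]
  have h6 : (|(d : ℝ)| / 2) ^ 3 * ‖ψ (z + d)‖ ≤ C :=
    le_trans (by gcongr) h5
  have h7 : |(d : ℝ)| * (‖ψ (z + d)‖ * |(d : ℝ)| ^ 2) ≤ |(d : ℝ)| * ε := by nlinarith
  exact le_of_mul_le_mul_left h7 (by linarith)

end RapidDecay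

/-- An entire function, rapidly decaying on strips, whose zeros are the integers outside
`(-N, N]`. -/
noncomputable def windowKernel (N : ℕ) (z : ℂ) : ℂ :=
  (Complex.Gamma (N + 1 - z))⁻¹ * (Complex.Gamma (N + z))⁻¹ * Complex.exp (-z ^ 2)

theorem differentiable_windowKernel (N : ℕ) : Differentiable ℂ (windowKernel N) := by
  have h := Complex.differentiable_one_div_Gamma
  have h1 : Differentiable ℂ fun z : ℂ => (Complex.Gamma (N + 1 - z))⁻¹ :=
    h.comp (f := fun z : ℂ => (N : ℂ) + 1 - z) (by fun_prop)
  have h2 : Differentiable ℂ fun z : ℂ => (Complex.Gamma (N + z))⁻¹ :=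
    h.comp (f := fun z : ℂ => (N : ℂ) + z) (by fun_prop)
  exact (h1.mul h2).mul (by fun_prop)

theorem windowKernel_succ (N : ℕ) (z : ℂ) :
    windowKernel N z = (N + 1 - z) * ((N + z) * windowKernel (N + 1) z) := by
  unfold windowKernel
  rw [Complex.one_div_Gamma_eq_self_mul_one_div_Gamma_add_one (N + 1 - z),
    Complex.one_div_Gamma_eq_self_mul_one_div_Gamma_add_one (N + z)]
  push_cast
  rw [show (N : ℂ) + 1 - z + 1 = N + 1 + 1 - z by ring, show (N : ℂ) + z + 1 = N + 1 + z by ring]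
  ring

theorem rapidDecay_windowKernel (N : ℕ) : RapidDecay (windowKernel N) := by
  induction N with
  | zero =>
    convert RapidDecay.sin_mul_exp_neg_sq.const_mul (Real.pi : ℂ)⁻¹ using 2 with z
    have h := Complex.Gamma_mul_Gamma_one_sub z
    rw [windowKernel, ← mul_inv, ← mul_assoc]
    congr 1
    rw [Nat.cast_zero, zero_add, zero_add, mul_comm, h, inv_div, div_eq_inv_mul]
  | succ N ih =>
    have hc := (differentiable_windowKernel (N + 1)).continuous
    refine .of_sub_mul hc (-(N : ℂ)) (.of_sub_mul (by fun_prop) (N + 1 : ℂ) ?_)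
    convert ih.const_mul (-1) using 2 with z
    rw [windowKernel_succ N z]
    ring

theorem windowKernel_ne_zero {N : ℕ} {z : ℂ} (h1 : -(N : ℝ) < z.re) (h2 : z.re < N + 1) :
    windowKernel N z ≠ 0 := by
  refine mul_ne_zero (mul_ne_zero (inv_ne_zero ?_) (inv_ne_zero ?_)) (Complex.exp_ne_zero _) <;>
  · apply Complex.Gamma_ne_zero_of_re_pos
    simp
    linarith

theorem windowKernel_eq_zero {N : ℕ} {j : ℤ} (hj : (N : ℤ) + 1 ≤ j ∨ j ≤ -N) :
    windowKernel N j = 0 := by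
  rcases hj with h | h
  · have : Complex.Gamma (N + 1 - (j : ℂ)) = 0 := by
      refine (Complex.Gamma_eq_zero_iff _).2 ⟨(j - N - 1).toNat, ?_⟩
      have : (((j - N - 1).toNat : ℤ) : ℂ) = ((j - N - 1 : ℤ) : ℂ) := by
        rw [Int.toNat_of_nonneg (by omega)]
      rw [← Int.cast_natCast (R := ℂ) (Int.toNat _), this]
      push_cast
      ring
    simp [windowKernel, this]
  · have : Complex.Gamma (N + (j : ℂ)) = 0 := by
      refine (Complex.Gamma_eq_zero_iff _).2 ⟨(-j - N).toNat, ?_⟩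
      have : (((-j - N).toNat : ℤ) : ℂ) = ((-j - N : ℤ) : ℂ) := by
        rw [Int.toNat_of_nonneg (by omega)]
      rw [← Int.cast_natCast (R := ℂ) (Int.toNat _), this]
      push_cast
      ring
    simp [windowKernel, this]

/-! ### Polynomial approximation -/

theorem exists_polynomial_approx {f : ℂ → ℂ} {R ρ : ℝ} (hR : 0 ≤ R) (hRρ : R < ρ)
    (hf : DifferentiableOn ℂ f (Metric.ball 0 ρ)) {ε : ℝ} (hε : 0 < ε) :
    ∃ p : Polynomial ℂ, ∀ z, ‖z‖ ≤ R → ‖p.eval z - f z‖ < ε := by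
  obtain ⟨s, hs1, hs2⟩ := exists_between hRρ
  obtain ⟨t, ht1, ht2⟩ := exists_between hs1
  lift s to NNReal using by linarith
  lift t to NNReal using by linarith
  have hs0 : 0 < s := lt_of_le_of_lt (zero_le (a := t)) (by exact_mod_cast ht2)
  have h := (hf.mono (Metric.closedBall_subset_ball hs2)).hasFPowerSeriesOnBall hs0
  have hu := h.tendstoUniformlyOn (r' := t) (by exact_mod_cast ht2)
  rw [Metric.tendstoUniformlyOn_iff] at hu
  obtain ⟨n, hn⟩ := (hu ε hε).exists
  refine ⟨∑ k ∈ Finset.range n,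
    Polynomial.C ((cauchyPowerSeries f 0 s).coeff k) * Polynomial.X ^ k, fun z hz => ?_⟩
  have := hn z (by simpa using lt_of_le_of_lt hz ht1)
  rw [dist_comm, dist_eq_norm, zero_add] at this
  refine lt_of_eq_of_lt ?_ this
  congr 2
  rw [Polynomial.eval_finsetSum]
  change _ = ∑ k ∈ Finset.range n, cauchyPowerSeries f 0 s k fun _ => z
  refine Finset.sum_congr rfl fun k _ => ?_
  rw [FormalMultilinearSeries.apply_eq_pow_smul_coeff]
  simp only [Polynomial.eval_mul, Polynomial.eval_C, Polynomial.eval_pow, Polynomial.eval_X,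
    smul_eq_mul]
  exact mul_comm _ _

/-- A polynomial can take the value `1` at a point outside a disc, vanish at finitely many other
points, and still be uniformly small on the disc. -/
theorem exists_polynomial_peak (J : Finset ℂ) {x : ℂ} (hx : x ∉ J) {R : ℝ} (hR : 0 ≤ R)
    (hRx : R < ‖x‖) {η : ℝ} (hη : 0 < η) :
    ∃ p : Polynomial ℂ, p.eval x = 1 ∧ (∀ y ∈ J, p.eval y = 0) ∧
      ∀ z, ‖z‖ ≤ R → ‖p.eval z‖ < η := by
  set V : Polynomial ℂ := ∏ y ∈ J, (Polynomial.X - Polynomial.C y) with hV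
  have hVx : V.eval x ≠ 0 := by
    rw [hV, Polynomial.eval_prod]
    refine Finset.prod_ne_zero_iff.2 fun y hy => ?_
    simp only [Polynomial.eval_sub, Polynomial.eval_X, Polynomial.eval_C]
    exact sub_ne_zero.2 fun h => hx (h ▸ hy)
  have hx0 : 0 < ‖x‖ := hR.trans_lt hRx
  obtain ⟨B, hB⟩ := (isCompact_closedBall (0 : ℂ) R).exists_bound_of_continuousOn
    (f := fun z => (V.eval x)⁻¹ * V.eval z) (by fun_prop)
  have ht : Tendsto (fun k : ℕ => (R / ‖x‖) ^ k * B) atTop (𝓝 (0 * B)) :=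
    (tendsto_pow_atTop_nhds_zero_of_lt_one (by positivity) ((div_lt_one hx0).2 hRx)).mul_const B
  rw [zero_mul] at ht
  obtain ⟨k, hk⟩ := (ht.eventually (gt_mem_nhds hη)).exists
  refine ⟨Polynomial.C (V.eval x)⁻¹ * V * (Polynomial.C x⁻¹ * Polynomial.X) ^ k, ?_, ?_, ?_⟩
  · simp [hVx, norm_pos_iff.1 hx0]
  · intro y hy
    have : V.eval y = 0 := by
      rw [hV, Polynomial.eval_prod]
      exact Finset.prod_eq_zero hy (by simp)
    simp [this]
  · intro z hz
    refine lt_of_le_of_lt ?_ hk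
    simp only [Polynomial.eval_mul, Polynomial.eval_C, Polynomial.eval_pow, Polynomial.eval_X]
    rw [norm_mul, mul_comm, norm_pow, norm_mul, norm_inv, ← div_eq_inv_mul]
    gcongr
    exact hB z (by simpa using hz)

/-! ### Blocks -/

/-- A block: a rapidly decaying entire function `ψ`, vanishing at the integers outside `(-N, N)`,
such that the values of `1 + ψ` on `[-N, 0)` and on `[0, N)` both accumulate to the factor `1`.
A translate of `ψ` added to a function with integer values `1` therefore leaves the accumulated
factor equal to `1` at the centre of the block and on both sides of it. -/
structure IsBlock (ψ : ℂ → ℂ) (N : ℕ) : Prop where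
  pos : 0 < N
  differentiable : Differentiable ℂ ψ
  decay : RapidDecay ψ
  vanish : ∀ j : ℤ, (N : ℤ) ≤ |j| → ψ j = 0
  left : orbitProduct (fun j => 1 + ψ j) (-N) N = 1
  right : orbitProduct (fun j => 1 + ψ j) 0 N = 1

/-- Blocks are dense. The function `(g - 1) / windowKernel` is approximated by a polynomial; a small
constant makes the integer values near the disc nonzero, and two polynomials that are small on the
disc adjust the outermost integer values so that both accumulated factors equal `1`. -/
theorem exists_block {g : ℂ → ℂ} (hg : Differentiable ℂ g) (R : ℝ) {ε : ℝ} (hε : 0 < ε) :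
    ∃ (ψ : ℂ → ℂ) (N : ℕ), IsBlock ψ N ∧ ∀ z, ‖z‖ ≤ R → ‖1 + ψ z - g z‖ < ε := by
  obtain ⟨r, hr⟩ := exists_nat_ge R
  have hr0 : (0 : ℝ) ≤ r := r.cast_nonneg
  set W := windowKernel (r + 2) with hW
  have hWd : Differentiable ℂ W := differentiable_windowKernel _
  have hW0 : ∀ j : ℤ, -((r : ℤ) + 1) ≤ j → j ≤ r + 2 → W j ≠ 0 := by
    intro j h1 h2
    have h1' : -((r : ℝ) + 1) ≤ j := by exact_mod_cast h1
    have h2' : (j : ℝ) ≤ r + 2 := by exact_mod_cast h2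
    refine windowKernel_ne_zero ?_ ?_ <;> push_cast <;> simp <;> linarith
  obtain ⟨B, hB⟩ := (isCompact_closedBall (0 : ℂ) r).exists_bound_of_continuousOn
    hWd.continuous.continuousOn
  have hB0 : 0 ≤ B := (norm_nonneg _).trans (hB 0 (by simp))
  set η : ℝ := ε / (4 * (B + 1)) with hη
  have hη0 : 0 < η := by positivity
  obtain ⟨T, hT⟩ := exists_polynomial_approx (f := fun z => (g z - 1) / W z) (R := r)
    (ρ := r + 1) hr0 (by linarith) (by
      refine DifferentiableOn.div (by fun_prop) hWd.differentiableOn fun z hz => ?_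
      have hz' : |z.re| < r + 1 := (Complex.abs_re_le_norm z).trans_lt (by simpa using hz)
      rw [abs_lt] at hz'
      refine windowKernel_ne_zero ?_ ?_ <;> push_cast <;> linarith) hη0
  -- Each integer in `[-r, r + 1]` excludes a single value of the constant `τ`.
  obtain ⟨τ, hτ, hτ'⟩ :=
    (infinite_of_mem_nhds (0 : ℂ) (Metric.ball_mem_nhds 0 hη0)).exists_notMem_finset
    ((Finset.Icc (-r : ℤ) (r + 1)).image fun j : ℤ => -(W j)⁻¹ - T.eval (j : ℂ))
  set b : ℤ → ℂ := fun j => 1 + (T.eval (j : ℂ) + τ) * W j with hb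
  have hb0 : ∀ j : ℤ, -(r : ℤ) ≤ j → j ≤ r + 1 → b j ≠ 0 := by
    intro j h1 h2 h
    refine hτ' (Finset.mem_image.2 ⟨j, Finset.mem_Icc.2 ⟨h1, h2⟩, ?_⟩)
    have hj := hW0 j (by omega) (by omega)
    simp only [hb] at h
    field_simp
    linear_combination -h
  set x : ℤ := -(r + 1 : ℤ) with hx
  set y : ℤ := r + 2 with hy
  obtain ⟨H, hH⟩ := IsAlgClosed.exists_pow_nat_eq (orbitProduct b (-r) r)⁻¹
    (n := 2 ^ r) (by positivity)
  have hQ1 : orbitProduct b (-r) r ≠ 0 :=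
    orbitProduct_ne_zero fun j hj => hb0 _ (by omega) (by omega)
  have hQ2 : orbitProduct b 0 (r + 2) ≠ 0 :=
    orbitProduct_ne_zero fun j hj => hb0 _ (by omega) (by omega)
  have hWx := hW0 x (by omega) (by omega)
  have hWy := hW0 y (by omega) (by omega)
  set A : ℂ := (H - b x) / W x with hA
  set D : ℂ := (((orbitProduct b 0 (r + 2)) ^ 2)⁻¹ - b y) / W y with hD
  have hinj : Function.Injective (fun j : ℤ => (j : ℂ)) := Int.cast_injective
  obtain ⟨p, hpx, hp0, hp⟩ := exists_polynomial_peak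
    ((Finset.Icc (-r : ℤ) (r + 2)).image fun j : ℤ => (j : ℂ)) (x := (x : ℂ)) (by
      rw [hinj.mem_finset_image, Finset.mem_Icc]; omega) hr0 (by
      rw [Complex.norm_intCast, hx]; push_cast; rw [abs_neg, abs_of_nonneg] <;> linarith)
    (η := η / (‖A‖ + 1)) (by positivity)
  obtain ⟨q, hqy, hq0, hq⟩ := exists_polynomial_peak
    ((Finset.Icc (-(r + 1) : ℤ) (r + 1)).image fun j : ℤ => (j : ℂ)) (x := (y : ℂ)) (by
      rw [hinj.mem_finset_image, Finset.mem_Icc]; omega) hr0 (by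
      rw [Complex.norm_intCast, hy]; push_cast; rw [abs_of_nonneg] <;> linarith)
    (η := η / (‖D‖ + 1)) (by positivity)
  have hp0' : ∀ j : ℤ, -(r : ℤ) ≤ j → j ≤ r + 2 → p.eval (j : ℂ) = 0 := fun j h1 h2 =>
    hp0 _ (Finset.mem_image_of_mem _ (Finset.mem_Icc.2 ⟨h1, h2⟩))
  have hq0' : ∀ j : ℤ, -(r + 1 : ℤ) ≤ j → j ≤ r + 1 → q.eval (j : ℂ) = 0 := fun j h1 h2 =>
    hq0 _ (Finset.mem_image_of_mem _ (Finset.mem_Icc.2 ⟨h1, h2⟩))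
  set t : Polynomial ℂ := T + Polynomial.C τ + Polynomial.C A * p + Polynomial.C D * q with ht
  have hte : ∀ z, t.eval z = T.eval z + τ + A * p.eval z + D * q.eval z := by
    intro z; simp [ht]
  set φ : ℤ → ℂ := fun j => 1 + t.eval (j : ℂ) * W j with hφ
  have hφb : ∀ j : ℤ, -(r : ℤ) ≤ j → j ≤ r + 1 → φ j = b j := by
    intro j h1 h2
    simp only [hφ, hb, hte, hp0' j h1 (by omega), hq0' j (by omega) h2]
    ring
  have hφx : φ x = H := by
    simp only [hφ, hte, hpx, hq0' x (by omega) (by omega), hA, hb]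
    field_simp
    ring
  have hφy : φ y = ((orbitProduct b 0 (r + 2)) ^ 2)⁻¹ := by
    simp only [hφ, hte, hqy, hp0' y (by omega) (by omega), hD]
    rw [mul_one, mul_zero, add_zero, add_mul, div_mul_cancel₀ _ hWy]
    simp only [hb]
    ring
  have hvan : ∀ j : ℤ, ((r + 3 : ℕ) : ℤ) ≤ |j| → t.eval (j : ℂ) * W j = 0 := by
    intro j hj
    rw [hW, windowKernel_eq_zero (by rw [le_abs] at hj; push_cast at hj ⊢; omega), mul_zero]
  refine ⟨fun z => t.eval z * W z, r + 3, ⟨by omega, t.differentiable.mul hWd,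
    (rapidDecay_windowKernel _).eval_mul t, hvan, ?_, ?_⟩, fun z hz => ?_⟩
  · change orbitProduct φ _ _ = 1
    have h3 : orbitProduct φ (-((r + 3 : ℕ) : ℤ)) 3 = H := by
      have e1 : φ (-((r + 3 : ℕ) : ℤ)) = 1 := by
        simp only [hφ]
        rw [hvan _ (by rw [abs_neg, Nat.abs_cast]), add_zero]
      have e2 : φ (-((r + 3 : ℕ) : ℤ) + 1) = 1 := by
        rw [show -((r + 3 : ℕ) : ℤ) + 1 = -(r + 2 : ℤ) by push_cast; ring]
        simp only [hφ]
        have : W ((-(r + 2 : ℤ) : ℤ) : ℂ) = 0 :=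
          windowKernel_eq_zero (Or.inr (by push_cast; omega))
        rw [this, mul_zero, add_zero]
      have e3 : φ (-((r + 3 : ℕ) : ℤ) + 2) = H := by
        rw [← hφx, hx]; congr 1
      simp only [orbitProduct]
      push_cast at e1 e2 e3 ⊢
      rw [add_zero, e1, e2, e3]
      ring
    have h4 : orbitProduct φ (-((r + 3 : ℕ) : ℤ) + (3 : ℕ)) r = orbitProduct b (-r) r := by
      refine orbitProduct_congr fun j hj => ?_
      rw [← hφb _ (by omega) (by omega)]
      congr 1; push_cast; ring
    rw [show orbitProduct φ (-((r + 3 : ℕ) : ℤ)) (r + 3) =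
      orbitProduct φ (-((r + 3 : ℕ) : ℤ)) (3 + r) by rw [add_comm], orbitProduct_add, h3, hH, h4,
      inv_mul_cancel₀ hQ1]
  · change orbitProduct φ _ _ = 1
    rw [orbitProduct, orbitProduct_congr (b := b) (m' := 0) fun j hj => ?_]
    · rw [show (0 : ℤ) + ((r + 2 : ℕ) : ℤ) = y by push_cast; omega, hφy,
        mul_inv_cancel₀ (pow_ne_zero _ hQ2)]
    · exact hφb _ (by omega) (by omega)
  · have hzr := hz.trans hr
    have hWz : W z ≠ 0 := by
      have hz' := (Complex.abs_re_le_norm z).trans hzr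
      rw [abs_le] at hz'
      refine windowKernel_ne_zero ?_ ?_ <;> push_cast <;> linarith
    have hAp : ‖A * p.eval z‖ < η := by
      rw [norm_mul]
      have := (lt_div_iff₀ (by positivity)).1 (hp z hzr)
      nlinarith [norm_nonneg (p.eval z)]
    have hDq : ‖D * q.eval z‖ < η := by
      rw [norm_mul]
      have := (lt_div_iff₀ (by positivity)).1 (hq z hzr)
      nlinarith [norm_nonneg (q.eval z)]
    have hτz : ‖τ‖ < η := by simpa using hτ
    have hTz := hT z hzr
    have e : 1 + t.eval z * W z - g z =
        ((T.eval z - (g z - 1) / W z) + τ + A * p.eval z + D * q.eval z) * W z := by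
      rw [hte]; field_simp; ring
    rw [e, norm_mul]
    have h4 : ‖(T.eval z - (g z - 1) / W z) + τ + A * p.eval z + D * q.eval z‖ < 4 * η := by
      have := norm_add₄_le (a := T.eval z - (g z - 1) / W z) (b := τ) (c := A * p.eval z)
        (d := D * q.eval z)
      linarith
    have h5 : ‖W z‖ < B + 1 := by linarith [hB z (by simpa using hzr)]
    calc _ < 4 * η * (B + 1) := mul_lt_mul'' h4 h5 (norm_nonneg _) (norm_nonneg _)
      _ = ε := by rw [hη]; field_simp

/-! ### Superposition of blocks -/

section Superposition

variable {ι : Type*} {c : ι → ℤ} {ψ : ι → ℂ → ℂ} {N : ι → ℕ}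

/-- The function equal to `1` plus the blocks `ψ i` translated to the centres `c i`. -/
noncomputable def superposition (c : ι → ℤ) (ψ : ι → ℂ → ℂ) (z : ℂ) : ℂ :=
  1 + ∑' i, ψ i (z - c i)

theorem differentiable_superposition (hψ : ∀ i, Differentiable ℂ (ψ i))
    (hc : Function.Injective c)
    (hconv : ∀ S : ℝ, ∀ᶠ i in cofinite, ∀ z : ℂ, ‖z‖ ≤ S → ‖ψ i (z - c i)‖ ≤ 1 / (c i : ℝ) ^ 2) :
    Differentiable ℂ (superposition c ψ) := by
  have key : ∀ S : ℝ, DifferentiableOn ℂ (fun z => ∑' i, ψ i (z - c i)) (Metric.ball 0 S) := by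
    intro S
    have hd : ∀ i, Differentiable ℂ fun z => ψ i (z - c i) := fun i =>
      (hψ i).comp (f := fun z : ℂ => z - c i) (by fun_prop)
    choose B hB using fun i => (isCompact_closedBall (0 : ℂ) S).exists_bound_of_continuousOn
      (hd i).continuous.continuousOn
    have hs : Summable fun i => 1 / (c i : ℝ) ^ 2 :=
      (Real.summable_one_div_int_pow.2 one_lt_two).comp_injective hc
    classical
    set u : ι → ℝ := fun i =>
      if ∀ z : ℂ, ‖z‖ ≤ S → ‖ψ i (z - c i)‖ ≤ 1 / (c i : ℝ) ^ 2 then 1 / (c i : ℝ) ^ 2 else B i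
    have hu : Summable u := by
      refine hs.congr_cofinite ?_
      filter_upwards [hconv S] with i hi
      simp only [u]
      rw [if_pos hi]
    refine Complex.differentiableOn_tsum_of_summable_norm hu (fun i => (hd i).differentiableOn)
      Metric.isOpen_ball fun i z hz => ?_
    have hz' : ‖z‖ ≤ S := by simpa using (Metric.mem_ball.1 hz).le
    simp only [u]
    split_ifs with h
    · exact h z hz'
    · exact hB i z (by simpa using hz')
  intro z
  exact ((key (‖z‖ + 1)).differentiableAt (Metric.isOpen_ball.mem_nhds (by simp))).const_add 1

/-- If the blocks are separated and none of them straddles `0`, the iterate of the superposition at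
the time of a centre is a pure translate: the accumulated factor is `1`. -/
theorem orbitProduct_superposition (hB : ∀ i, IsBlock (ψ i) (N i))
    (hsep : ∀ i j, i ≠ j → (N i + N j : ℤ) ≤ |c i - c j|)
    (hzero : ∀ i, c i = 0 ∨ (N i : ℤ) ≤ |c i|) {i : ι} {n : ℕ} (hn : c i = n) :
    orbitProduct (fun j => superposition c ψ j) 0 n = 1 := by
  set a : ℤ → ℂ := fun j => superposition c ψ j with ha
  have hpos := fun i => (hB i).pos
  have a_block : ∀ (i : ι) (m : ℤ), |m - c i| ≤ N i → a m = 1 + ψ i ((m - c i : ℤ) : ℂ) := by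
    intro i m hm
    simp only [ha, superposition]
    rw [tsum_eq_single i fun j hj => ?_]
    · push_cast; rfl
    · have := (hB j).vanish (m - c j) (by
        have := hsep i j hj.symm
        rw [abs_le] at hm
        rw [le_abs] at this ⊢
        omega)
      push_cast at this
      exact this
  have a_one : ∀ m : ℤ, (∀ i, (N i : ℤ) ≤ |m - c i|) → a m = 1 := by
    intro m hm
    simp only [ha, superposition]
    rw [tsum_congr fun j => ?_, tsum_zero, add_zero]
    have := (hB j).vanish (m - c j) (hm j)
    push_cast at this
    exact this
  suffices h : ∀ m : ℕ, (∀ i, (m : ℤ) = c i ∨ (N i : ℤ) ≤ |m - c i|) →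
      orbitProduct a 0 m = 1 by
    refine h n fun j => ?_
    rcases eq_or_ne j i with rfl | hj
    · exact Or.inl hn.symm
    · have h1 := hsep i j hj.symm
      rw [hn] at h1
      exact Or.inr (by omega)
  -- A position strictly inside no half-block is reached from the previous such position.
  intro m
  induction m using Nat.strong_induction_on with
  | _ m ih =>
  intro hm
  rcases Nat.eq_zero_or_pos m with rfl | hm0
  · rfl
  have step : ∀ k : ℕ, k < m → (∀ i, (k : ℤ) = c i ∨ (N i : ℤ) ≤ |k - c i|) →
      orbitProduct a k (m - k) = 1 → orbitProduct a 0 m = 1 := by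
    intro k hk hk' h
    rw [show m = k + (m - k) by omega, orbitProduct_add, ih k hk hk', zero_add, h, one_pow, one_mul]
  by_cases hin : ∃ i, |((m - 1 : ℕ) : ℤ) - c i| < N i
  · obtain ⟨i, hi⟩ := hin
    have hmi := hm i
    have hzi := hzero i
    have hpi := hpos i
    have hcase : (m : ℤ) = c i ∨ (m : ℤ) = c i + N i := by
      rw [abs_lt] at hi
      rw [le_abs] at hmi
      omega
    rcases hcase with hmc | hmc
    · have hNm : N i ≤ m := by rw [le_abs] at hzi; omega
      refine step (m - N i) (by omega) (fun j => Or.inr ?_) ?_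
      · rcases eq_or_ne i j with rfl | hj
        · rw [le_abs]; omega
        · have := hsep i j hj
          rw [le_abs] at this ⊢
          omega
      · rw [show m - (m - N i) = N i by omega, ← (hB i).left]
        refine orbitProduct_congr fun j hj => ?_
        rw [a_block i _ (by rw [abs_le]; omega)]
        congr 3
        omega
    · have hc0 : 0 ≤ c i := by rw [le_abs] at hzi; omega
      refine step (c i).toNat (by omega) (fun j => ?_) ?_
      · rw [Int.toNat_of_nonneg hc0]
        rcases eq_or_ne i j with rfl | hj
        · exact Or.inl rfl
        · exact Or.inr (by have := hsep i j hj; omega)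
      · rw [show m - (c i).toNat = N i by omega, ← (hB i).right]
        refine orbitProduct_congr fun j hj => ?_
        rw [a_block i _ (by rw [abs_le]; omega)]
        congr 3
        omega
  · push Not at hin
    refine step (m - 1) (by omega) (fun i => Or.inr (hin i)) ?_
    rw [show m - (m - 1) = 1 by omega]
    simp [orbitProduct, a_one _ hin]

/-- Near the centre `c i` the superposition is governed by the `i`-th block alone, if the other
blocks are small there. The term `d = 0` of the constant is `1 / 0 = 0`. -/
theorem norm_superposition_sub_le (hc : Function.Injective c) {i : ι} {z : ℂ} {δ : ℝ} (hδ : 0 ≤ δ)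
    (h : ∀ j, j ≠ i → ‖ψ j (z + (c i - c j : ℤ))‖ ≤ δ / ((c i - c j : ℤ) : ℝ) ^ 2) :
    ‖superposition c ψ (z + c i) - (1 + ψ i z)‖ ≤ δ * ∑' d : ℤ, 1 / (d : ℝ) ^ 2 := by
  classical
  have hinj : Function.Injective fun j => c i - c j := fun j k hjk => hc (by simpa using hjk)
  have hsZ : Summable fun d : ℤ => 1 / (d : ℝ) ^ 2 := Real.summable_one_div_int_pow.2 one_lt_two
  have hs : Summable fun j => δ * (1 / ((c i - c j : ℤ) : ℝ) ^ 2) :=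
    (hsZ.comp_injective hinj).mul_left δ
  have hle : ∀ j, ‖if j = i then 0 else ψ j (z + c i - c j)‖ ≤
      δ * (1 / ((c i - c j : ℤ) : ℝ) ^ 2) := by
    intro j
    split_ifs with hj
    · rw [norm_zero]; positivity
    · have := h j hj
      rw [Int.cast_sub, ← add_sub_assoc] at this
      rwa [mul_one_div]
  have hs' : Summable fun j => if j = i then 0 else ψ j (z + c i - c j) :=
    Summable.of_norm_bounded hs hle
  have hs'' : Summable fun j => ψ j (z + c i - c j) := by
    refine hs'.congr_cofinite ?_
    filter_upwards [(Set.finite_singleton i).compl_mem_cofinite] with j hj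
    exact if_neg hj
  have e : superposition c ψ (z + c i) - (1 + ψ i z) =
      ∑' j, if j = i then 0 else ψ j (z + c i - c j) := by
    rw [superposition, hs''.tsum_eq_add_tsum_ite i, add_sub_cancel_right]
    ring
  rw [e]
  refine (tsum_of_norm_bounded hs.hasSum hle).trans ?_
  rw [tsum_mul_left]
  refine mul_le_mul_of_nonneg_left ?_ hδ
  exact (hsZ.comp_injective hinj).tsum_le_tsum_of_inj (fun j => c i - c j) hinj
    (fun _ _ => by positivity) (fun _ => le_rfl) hsZ

/-- An entire function whose iterate at the time of each centre is close to the corresponding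
block. -/
theorem exists_superposition (hB : ∀ i, IsBlock (ψ i) (N i))
    (hsep : ∀ i j, i ≠ j → (N i + N j : ℤ) ≤ |c i - c j|)
    (hzero : ∀ i, c i = 0 ∨ (N i : ℤ) ≤ |c i|)
    (hconv : ∀ S : ℝ, ∀ᶠ i in cofinite, ∀ z : ℂ, ‖z‖ ≤ S → ‖ψ i (z - c i)‖ ≤ 1 / (c i : ℝ) ^ 2) :
    ∃ F : EntireFunctions, (∀ z, F.1 z = superposition c ψ z) ∧
      (∀ i (n : ℕ), c i = n → ∀ z, (evalMulTranslate^[n] F).1 z = F.1 (z + n)) ∧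
      ∀ i (δ : ℝ) (z : ℂ), 0 ≤ δ →
        (∀ j, j ≠ i → ‖ψ j (z + (c i - c j : ℤ))‖ ≤ δ / ((c i - c j : ℤ) : ℝ) ^ 2) →
        ‖F.1 (z + c i) - (1 + ψ i z)‖ ≤ δ * ∑' d : ℤ, 1 / (d : ℝ) ^ 2 := by
  have hc : Function.Injective c := by
    intro i j hij
    by_contra hne
    have h1 := hsep i j hne
    have h2 := (hB i).pos
    rw [hij, sub_self, abs_zero] at h1
    omega
  have hd := differentiable_superposition (fun i => (hB i).differentiable) hc hconv
  refine ⟨⟨⟨superposition c ψ, hd.continuous⟩, hd⟩, fun z => rfl, fun i n hn z => ?_,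
    fun i δ z hδ h => norm_superposition_sub_le hc hδ h⟩
  rw [iterate_evalMulTranslate]
  have := orbitProduct_superposition hB hsep hzero hn
  exact (congrArg (· * _) this).trans (one_mul _)

end Superposition

/-! ### Separated sets of positive lower density -/

theorem HasPositiveLowerDensity.of_eventually_le {A : Set ℕ} {κ : ℝ} (hκ : 0 < κ)
    (h : ∀ᶠ n : ℕ in atTop, κ * n ≤ ({x ∈ A | x ≤ n}.ncard : ℝ)) :
    HasPositiveLowerDensity A := by
  refine hκ.trans_le (le_liminf_of_le ?_ ?_)
  · refine IsBoundedUnder.isCoboundedUnder_ge ⟨2, ?_⟩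
    rw [eventually_map]
    filter_upwards [eventually_ge_atTop 1] with n hn
    have h1 : {x ∈ A | x ≤ n}.ncard ≤ n + 1 := by
      have : {x ∈ A | x ≤ n} ⊆ (Finset.range (n + 1) : Set ℕ) := fun x hx => by
        simpa using Nat.lt_succ_of_le hx.2
      simpa [Set.ncard_coe_finset] using Set.ncard_le_ncard this (Finset.finite_toSet _)
    have h2 : (1 : ℝ) ≤ n := by exact_mod_cast hn
    have h3 : ({x ∈ A | x ≤ n}.ncard : ℝ) ≤ n + 1 := by exact_mod_cast h1
    rw [div_le_iff₀ (by linarith)]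
    linarith
  · filter_upwards [h, eventually_ge_atTop 1] with n hn hn1
    rwa [le_div_iff₀ (by exact_mod_cast hn1)]

theorem HasPositiveLowerDensity.nonempty {A : Set ℕ} (h : HasPositiveLowerDensity A) :
    A.Nonempty := by
  by_contra hA
  rw [Set.not_nonempty_iff_eq_empty] at hA
  simp [HasPositiveLowerDensity, hA] at h

/-- Given gaps `G l`, there are sets `A l` of positive lower density such that distinct points
labelled `l` and `l'` are at least `G (max l l')` apart. One takes periodic sets whose periods
`L l` grow fast, and deletes from the `l`-th one the points too close to the `k`-th one for some
`k > l`; the deleted proportion is at most half. -/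
theorem exists_separated_sets (G : ℕ → ℕ) (hG : ∀ l, 0 < G l) :
    ∃ A : ℕ → Set ℕ, (∀ l, ∀ n ∈ A l, G l ≤ n) ∧
      (∀ l l' n n', n ∈ A l → n' ∈ A l' → (l, n) ≠ (l', n') →
        (G (max l l') : ℤ) ≤ |(n : ℤ) - n'|) ∧
      ∀ l, ∃ κ : ℝ, 0 < κ ∧ ∀ᶠ n : ℕ in atTop, κ * n ≤ ({x ∈ A l | x ≤ n}.ncard : ℝ) := by
  classical
  set L : ℕ → ℕ := fun k => ∏ i ∈ Finset.range (k + 1), 16 * G i * 2 ^ i with hL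
  have hLpos : ∀ k, 0 < L k := fun k => Finset.prod_pos fun i _ => by have := hG i; positivity
  have hLsucc : ∀ k, L (k + 1) = L k * (16 * G (k + 1) * 2 ^ (k + 1)) := fun k =>
    Finset.prod_range_succ _ _
  have hLmono : Monotone L := monotone_nat_of_le_succ fun k => by
    rw [hLsucc]
    exact Nat.le_mul_of_pos_right _ (by have := hG (k + 1); positivity)
  have hLlt : ∀ l k, l < k → L l * (16 * G k * 2 ^ k) ≤ L k := by
    intro l k hlk
    obtain ⟨k, rfl⟩ : ∃ k', k = k' + 1 := ⟨k - 1, by omega⟩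
    rw [hLsucc]
    exact Nat.mul_le_mul_right _ (hLmono (by omega))
  have hLG : ∀ k, 16 * G k * 2 ^ k ≤ L k := by
    intro k
    rcases k with _ | k
    · simp [hL]
    · rw [hLsucc]; exact Nat.le_mul_of_pos_left _ (hLpos k)
  have hLG' : ∀ k, 4 * G k + k ≤ L k := by
    intro k
    have h1 := hLG k
    have h2 : k < 2 ^ k := Nat.lt_two_pow_self
    have h3 := hG k
    nlinarith
  -- The shift by `G k` puts the `k`-th set just before the positive multiples of `L k`, so it
  -- deletes no point below `L k - 2 * G k`, and only finitely many `k` affect a given point.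
  refine ⟨fun l => {n | L l ∣ n + G l ∧
      ∀ k, l < k → ∀ m : ℕ, L k ∣ m + G k → (G k : ℤ) ≤ |(n : ℤ) - m|}, ?_, ?_, ?_⟩
  · rintro l n ⟨h, -⟩
    have := Nat.le_of_dvd (by have := hG l; omega) h
    have := hLG' l
    omega
  · rintro l l' n n' ⟨h1, h2⟩ ⟨h1', h2'⟩ hne
    rcases lt_trichotomy l l' with h | rfl | h
    · rw [max_eq_right h.le]; exact h2 l' h n' h1'
    · have hnn : (n : ℤ) - n' ≠ 0 := fun h => hne (by rw [show n = n' by omega])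
      have hd : (L l : ℤ) ∣ n - n' := by
        have := dvd_sub (Int.natCast_dvd_natCast.2 h1) (Int.natCast_dvd_natCast.2 h1')
        push_cast at this
        rwa [add_sub_add_right_eq_sub] at this
      have := Int.le_of_dvd (abs_pos.2 hnn) ((dvd_abs _ _).2 hd)
      have := hLG' l
      rw [max_self]
      omega
    · rw [max_eq_left h.le, abs_sub_comm]; exact h2' l h n h1
  · intro l
    have hl0 : (0 : ℝ) < L l := by exact_mod_cast hLpos l
    refine ⟨1 / (4 * L l), by positivity, ?_⟩
    filter_upwards [eventually_ge_atTop (4 * L l)] with n hn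
    set A : Set ℕ := {n | L l ∣ n + G l ∧
      ∀ k, l < k → ∀ m : ℕ, L k ∣ m + G k → (G k : ℤ) ≤ |(n : ℤ) - m|} with hA
    set A' : Finset ℕ := (Finset.range (n + 1)).filter (· ∈ A) with hA'
    have hAA : {x ∈ A | x ≤ n} = (A' : Set ℕ) := by
      ext x
      simp [hA', and_comm]
    change _ ≤ ({x ∈ A | x ≤ n}.ncard : ℝ)
    rw [hAA, Set.ncard_coe_finset]
    set B : Finset ℕ := (Finset.range (n / L l)).image fun j => (j + 1) * L l - G l with hB
    set D : ℕ → Finset ℕ := fun k =>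
      (Finset.range ((n + 2 * G k) / L k) ×ˢ Finset.range (2 * G k)).image
        fun p => (p.1 + 1) * L k + p.2 - 2 * G k with hD
    have hle : ∀ k j, L k ≤ (j + 1) * L k := fun k j => Nat.le_mul_of_pos_left _ (by omega)
    have hBcard : B.card = n / L l := by
      rw [hB, Finset.card_image_of_injective, Finset.card_range]
      intro i j hij
      have h1 := hle l i
      have h2 := hle l j
      have h3 := hLG' l
      have h4 : (i + 1) * L l = (j + 1) * L l := by simp only at hij; omega
      have := Nat.eq_of_mul_eq_mul_right (hLpos l) h4
      omega
    have hsub : B ⊆ A' ∪ (Finset.Ioc l n).biUnion D := by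
      intro x hx
      obtain ⟨j, hj, rfl⟩ := Finset.mem_image.1 hx
      rw [Finset.mem_range] at hj
      have h1 := hle l j
      have h3 := hLG' l
      have hjn : (j + 1) * L l ≤ n := (Nat.mul_le_mul_right _ hj).trans (Nat.div_mul_le_self _ _)
      set x := (j + 1) * L l - G l with hx
      have hxG : x + G l = (j + 1) * L l := by omega
      by_cases hxA : x ∈ A
      · exact Finset.mem_union_left _ (Finset.mem_filter.2 ⟨Finset.mem_range.2 (by omega), hxA⟩)
      refine Finset.mem_union_right _ ?_
      have : ∃ k, l < k ∧ ∃ m : ℕ, L k ∣ m + G k ∧ |(x : ℤ) - m| < G k := by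
        by_contra hcon
        push Not at hcon
        exact hxA ⟨⟨j + 1, by rw [hxG, mul_comm]⟩, hcon⟩
      obtain ⟨k, hk, m, ⟨q, hq⟩, hm⟩ := this
      rw [abs_lt] at hm
      have hGk := hG k
      obtain ⟨q, rfl⟩ : ∃ q', q = q' + 1 := by
        rcases q with _ | q
        · rw [mul_zero] at hq; omega
        · exact ⟨q, rfl⟩
      rw [mul_comm] at hq
      have h4 := hle k q
      have h5 := hLG' k
      refine Finset.mem_biUnion.2 ⟨k, Finset.mem_Ioc.2 ⟨hk, by omega⟩,
        Finset.mem_image.2 ⟨(q, x + G k - m), ?_, by simp only; omega⟩⟩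
      simp only [Finset.mem_product, Finset.mem_range]
      refine ⟨?_, by omega⟩
      rw [← Nat.succ_le_iff, Nat.le_div_iff_mul_le (hLpos k), Nat.succ_eq_add_one]
      omega
    have hDcard : ∀ k ∈ Finset.Ioc l n, ((D k).card : ℝ) ≤ n / (4 * L l) * (1 / 2) ^ k := by
      intro k hk
      rw [Finset.mem_Ioc] at hk
      have h1 : (D k).card ≤ (n + 2 * G k) / L k * (2 * G k) := by
        refine Finset.card_image_le.trans ?_
        rw [Finset.card_product, Finset.card_range, Finset.card_range]
      rcases lt_or_ge (n + 2 * G k) (L k) with h2 | h2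
      · rw [Nat.div_eq_of_lt h2, zero_mul] at h1
        rw [Nat.le_zero.1 h1, Nat.cast_zero]
        positivity
      · have h3 := hLG' k
        have h4 : (n + 2 * G k) / L k ≤ 2 * n / L k := Nat.div_le_div_right (by omega)
        have hk0 : (0 : ℝ) < L k := by exact_mod_cast hLpos k
        have h5 : ((2 * n / L k : ℕ) : ℝ) ≤ 2 * n / L k := by
          simpa using Nat.cast_div_le (α := ℝ) (m := 2 * n) (n := L k)
        have h6 : ((D k).card : ℝ) ≤ 2 * n / L k * (2 * G k) := by
          calc ((D k).card : ℝ) ≤ ((2 * n / L k : ℕ) : ℝ) * (2 * G k) := by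
                exact_mod_cast h1.trans (Nat.mul_le_mul_right _ h4)
            _ ≤ _ := by gcongr
        refine h6.trans ?_
        have h7 : (L l : ℝ) * (16 * G k * 2 ^ k) ≤ L k := by exact_mod_cast hLlt l k hk.1
        rw [one_div, inv_pow, div_mul_eq_mul_div, ← div_eq_mul_inv, div_div, div_le_div_iff₀ hk0
          (by positivity)]
        have hn0 : (0 : ℝ) ≤ n := n.cast_nonneg
        nlinarith [mul_le_mul_of_nonneg_left h7 hn0]
    have hDsum : ((∑ k ∈ Finset.Ioc l n, (D k).card : ℕ) : ℝ) ≤ n / (2 * L l) := by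
      push_cast
      refine (Finset.sum_le_sum hDcard).trans ?_
      rw [← Finset.mul_sum]
      have : ∑ k ∈ Finset.Ioc l n, (1 / 2 : ℝ) ^ k ≤ 2 := by
        refine le_of_le_of_eq ?_ tsum_geometric_two
        exact summable_geometric_two.sum_le_tsum _ fun _ _ => by positivity
      calc _ ≤ n / (4 * L l : ℝ) * 2 := by gcongr
        _ = _ := by field_simp; ring
    have hcard : ((n / L l : ℕ) : ℝ) ≤ A'.card + (∑ k ∈ Finset.Ioc l n, (D k).card : ℕ) := by
      rw [← hBcard]
      exact_mod_cast (Finset.card_le_card hsub).trans ((Finset.card_union_le _ _).trans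
        (Nat.add_le_add_left Finset.card_biUnion_le _))
    have hfloor : (n : ℝ) / L l - 1 < ((n / L l : ℕ) : ℝ) := by
      have := Nat.lt_div_mul_add (a := n) (hLpos l)
      rw [sub_lt_iff_lt_add, div_lt_iff₀ hl0, add_mul, one_mul]
      exact_mod_cast this
    have hn' : 1 ≤ (n : ℝ) / L l / 4 := by
      rw [div_div, le_div_iff₀ (by positivity), one_mul, mul_comm]
      exact_mod_cast hn
    have e1 : (n : ℝ) / (2 * L l) = n / L l / 2 := by field_simp
    have e2 : 1 / (4 * L l : ℝ) * n = n / L l / 4 := by field_simp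
    rw [e1] at hDsum
    rw [e2]
    linarith

/-! ### Dynamics of `evalMulTranslate` -/

theorem isHomogeneousPolynomial_evalMulTranslate :
    IsHomogeneousPolynomial 2 evalMulTranslate := by
  refine ⟨⟨⟨fun v => ⟨(v 0).1 0 • (v 1).1.comp ⟨fun z => z + 1, by fun_prop⟩, ?_⟩, ?_, ?_⟩, ?_⟩, ?_⟩
  · have h : Differentiable ℂ (v 1).1 := (v 1).2
    exact (h.comp (differentiable_id.add_const (1 : ℂ))).const_mul ((v 0).1 0)
  · intro _ v i x y
    apply Subtype.ext
    ext z
    fin_cases i <;> simp [Function.update] <;> ring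
  · intro _ v i r x
    apply Subtype.ext
    ext z
    fin_cases i <;> simp [Function.update] <;> ring
  · refine Continuous.subtype_mk ?_ _
    have h0 : Continuous fun v : Fin 2 → EntireFunctions => (v 0).1 0 :=
      (continuous_eval_const (0 : ℂ)).comp (continuous_subtype_val.comp (continuous_apply 0))
    have h1 : Continuous fun v : Fin 2 → EntireFunctions =>
        (v 1).1.comp (⟨fun z => z + 1, by fun_prop⟩ : C(ℂ, ℂ)) :=
      (ContinuousMap.continuous_precomp _).comp
        (continuous_subtype_val.comp (continuous_apply 1))
    exact h0.smul h1
  · intro f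
    rfl

/-- Open sets of entire functions contain uniform neighbourhoods on discs. -/
theorem exists_uniform_nhd {U : Set EntireFunctions} (hU : IsOpen U) {g : EntireFunctions}
    (hg : g ∈ U) : ∃ (R ε : ℝ), 0 < ε ∧
      ∀ f : EntireFunctions, (∀ z, ‖z‖ ≤ R → ‖f.1 z - g.1 z‖ < ε) → f ∈ U := by
  by_contra hcon
  push Not at hcon
  choose f hf hfU using fun n : ℕ => hcon n (1 / (n + 1)) (by positivity)
  have ht : Tendsto f atTop (𝓝 g) := by
    rw [tendsto_subtype_rng, ContinuousMap.tendsto_iff_forall_isCompact_tendstoUniformlyOn]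
    intro K hK
    rw [Metric.tendstoUniformlyOn_iff]
    intro ε hε
    obtain ⟨R, hR⟩ := hK.isBounded.exists_norm_le
    filter_upwards [tendsto_one_div_add_atTop_nhds_zero_nat.eventually (gt_mem_nhds hε),
      eventually_ge_atTop ⌈R⌉₊] with n hn hnR z hz
    rw [dist_comm, dist_eq_norm]
    exact (hf n z ((hR z hz).trans (Nat.ceil_le.1 hnR))).trans hn
  obtain ⟨n, hn⟩ := (ht.eventually (hU.mem_nhds hg)).exists
  exact hfU n hn

/-- Every nonempty open set contains all functions close to a suitable block on a disc, with the
error written in the form provided by `exists_superposition`. -/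
theorem exists_block_nhd {U : Set EntireFunctions} (hU : IsOpen U) (hne : U.Nonempty) :
    ∃ (ψ : ℂ → ℂ) (N : ℕ) (R δ : ℝ), IsBlock ψ N ∧ 0 < δ ∧ ∀ f : EntireFunctions,
      (∀ z, ‖z‖ ≤ R → ‖f.1 z - (1 + ψ z)‖ ≤ δ * ∑' d : ℤ, 1 / (d : ℝ) ^ 2) → f ∈ U := by
  obtain ⟨g, hg⟩ := hne
  obtain ⟨R, ε, hε, h⟩ := exists_uniform_nhd hU hg
  obtain ⟨ψ, N, hψ, hψg⟩ := exists_block (g := g.1) g.2 R (half_pos hε)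
  set K : ℝ := ∑' d : ℤ, 1 / (d : ℝ) ^ 2
  have hK : 0 ≤ K := tsum_nonneg fun _ => by positivity
  refine ⟨ψ, N, R, ε / (2 * (K + 1)), hψ, by positivity, fun f hf => h f fun z hz => ?_⟩
  have h1 := hf z hz
  have h2 := hψg z hz
  have h3 : ε / (2 * (K + 1)) * K ≤ ε / 2 := by
    rw [div_mul_eq_mul_div, div_le_div_iff₀ (by positivity) two_pos]
    nlinarith
  have h4 := norm_add_le (f.1 z - (1 + ψ z)) (1 + ψ z - g.1 z)
  rw [sub_add_sub_cancel] at h4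
  linarith

/-- Superpose a block close to a point of `U` at `0` and one close to a point of `V` at `n`. -/
theorem isMixing_evalMulTranslate : IsMixing evalMulTranslate := by
  intro U V hU hUne hV hVne
  obtain ⟨ψ₁, N₁, R₁, δ₁, hψ₁, hδ₁, h₁⟩ := exists_block_nhd hU hUne
  obtain ⟨ψ₂, N₂, R₂, δ₂, hψ₂, hδ₂, h₂⟩ := exists_block_nhd hV hVne
  obtain ⟨G₁, hG₁⟩ := hψ₁.decay.translate_le R₂ hδ₂
  obtain ⟨G₂, hG₂⟩ := hψ₂.decay.translate_le R₁ hδ₁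
  refine ⟨N₁ + N₂ + G₁ + G₂, fun n hn => ?_⟩
  obtain ⟨F, -, hF, hF'⟩ := exists_superposition (ι := Bool) (c := fun b => cond b (n : ℤ) 0)
    (ψ := fun b => cond b ψ₂ ψ₁) (N := fun b => cond b N₂ N₁)
    (by rintro (_ | _) <;> assumption)
    (by
      rintro (_ | _) (_ | _) h
      · exact absurd rfl h
      · simp; omega
      · simp; omega
      · exact absurd rfl h)
    (by
      rintro (_ | _)
      · exact Or.inl rfl
      · simp; omega)
    (fun S => by rw [cofinite_eq_bot]; exact eventually_bot)
  refine ⟨evalMulTranslate^[n] F, ⟨F, h₁ F fun z hz => ?_, rfl⟩, h₂ _ fun z hz => ?_⟩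
  · have := hF' false δ₁ z hδ₁.le (by
      rintro (_ | _) h
      · exact absurd rfl h
      · exact hG₂ _ (by simp; omega) z hz)
    simpa using this
  · rw [hF true n rfl z]
    have := hF' true δ₂ z hδ₂.le (by
      rintro (_ | _) h
      · exact hG₁ _ (by simp; omega) z hz
      · exact absurd rfl h)
    simpa using this

/-- Superpose translates of one block at all multiples of a large period. -/
theorem dense_periodicPts_evalMulTranslate : Dense (Function.periodicPts evalMulTranslate) := by
  rw [dense_iff_inter_open]
  intro U hU hUne
  obtain ⟨ψ, N, R, δ, hψ, hδ, h⟩ := exists_block_nhd hU hUne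
  obtain ⟨G, hG⟩ := hψ.decay.translate_le R hδ
  set p : ℕ := 2 * N + G with hp
  have hp0 : 0 < p := by have := hψ.pos; omega
  have habs : ∀ k : ℤ, k ≠ 0 → (p : ℤ) ≤ |p * k| := by
    intro k hk
    rw [abs_mul, Nat.abs_cast]
    exact le_mul_of_one_le_right (by positivity) (Int.one_le_abs hk)
  obtain ⟨F, hFs, hF, hF'⟩ := exists_superposition (ι := ℤ) (c := fun i => p * i)
    (ψ := fun _ => ψ) (N := fun _ => N) (fun _ => hψ)
    (fun i j hij => by
      have := habs (i - j) (sub_ne_zero.2 hij)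
      rw [← mul_sub]
      omega)
    (fun i => by
      rcases eq_or_ne i 0 with rfl | hi
      · exact Or.inl (mul_zero _)
      · have := habs i hi
        exact Or.inr (by omega))
    (fun S => by
      obtain ⟨M, hM⟩ := hψ.decay.translate_le S one_pos
      refine (Set.finite_Icc (-M : ℤ) M).subset fun i hi => ?_
      by_contra hiM
      refine hi fun z hz => ?_
      have h1 : (M : ℤ) ≤ |-(p * i : ℤ)| := by
        rw [abs_neg, abs_mul, Nat.abs_cast]
        have h2 : (M : ℤ) ≤ |i| := by
          rw [Set.mem_Icc, ← abs_le] at hiM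
          omega
        exact h2.trans (le_mul_of_one_le_left (abs_nonneg i) (by exact_mod_cast hp0))
      have := hM _ h1 z hz
      push_cast at this ⊢
      rwa [← sub_eq_add_neg, neg_sq] at this)
  refine ⟨F, h F fun z hz => ?_, p, hp0, ?_⟩
  · have := hF' 0 δ z hδ.le (fun j hj => hG _ (by
      rw [← mul_sub]
      have := habs (0 - j) (by simpa using hj)
      omega) z hz)
    simpa using this
  · apply Subtype.ext
    ext z
    rw [hF 1 p (mul_one _), hFs, hFs, superposition, superposition,
      ← (Equiv.addRight (1 : ℤ)).tsum_eq]
    congr 1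
    refine tsum_congr fun i => ?_
    congr 1
    simp
    ring

/-- Superpose blocks approximating every member of a countable basis, the `l`-th one centred at the
points of the `l`-th set of a separated family of sets of positive lower density. -/
theorem isFrequentlyHypercyclic_evalMulTranslate :
    IsFrequentlyHypercyclic evalMulTranslate := by
  have : SecondCountableTopology EntireFunctions :=
    TopologicalSpace.Subtype.secondCountableTopology _
  obtain ⟨b, hbc, hbe, hb⟩ := TopologicalSpace.exists_countable_basis EntireFunctions
  have hbne : b.Nonempty := by
    obtain ⟨v, hv, -⟩ := hb.exists_subset_of_mem_open (Set.mem_univ (0 : EntireFunctions))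
      isOpen_univ
    exact ⟨v, hv⟩
  obtain ⟨V, rfl⟩ := hbc.exists_eq_range hbne
  choose ψ N R δ hψ hδ hV using fun l => exists_block_nhd (hb.isOpen (Set.mem_range_self l))
    (Set.nonempty_iff_ne_empty.2 fun h => hbe (h ▸ Set.mem_range_self l))
  choose g hg using fun k l : ℕ => (hψ k).decay.translate_le (max l (R l))
    (lt_min one_pos (hδ l))
  set G : ℕ → ℕ := fun l => (∑ k ∈ Finset.range (l + 1), ∑ m ∈ Finset.range (l + 1), g k m) +
    2 * ∑ k ∈ Finset.range (l + 1), N k + 1 with hG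
  have hNG : ∀ k l, k ≤ l → 2 * N k ≤ G l := by
    intro k l hkl
    have := Finset.single_le_sum (f := N) (fun _ _ => Nat.zero_le _)
      (Finset.mem_range.2 (Nat.lt_succ_of_le hkl) : k ∈ Finset.range (l + 1))
    simp only [hG]
    omega
  have hgG : ∀ k m l, k ≤ l → m ≤ l → g k m ≤ G l := by
    intro k m l hkl hml
    have h1 := Finset.single_le_sum (f := fun m => g k m) (fun _ _ => Nat.zero_le _)
      (Finset.mem_range.2 (Nat.lt_succ_of_le hml) : m ∈ Finset.range (l + 1))
    have h2 := Finset.single_le_sum (f := fun k => ∑ m ∈ Finset.range (l + 1), g k m)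
      (fun _ _ => Nat.zero_le _) (Finset.mem_range.2 (Nat.lt_succ_of_le hkl) : k ∈ Finset.range (l + 1))
    simp only [hG] at h1 h2 ⊢
    omega
  obtain ⟨A, hA, hAsep, hAd⟩ := exists_separated_sets G fun l => Nat.succ_pos _
  obtain ⟨F, -, hF, hF'⟩ := exists_superposition (ι := {p : ℕ × ℕ // p.2 ∈ A p.1})
    (c := fun i => (i.1.2 : ℤ)) (ψ := fun i => ψ i.1.1) (N := fun i => N i.1.1)
    (fun i => hψ _)
    (fun i j hij => by
      have := hAsep _ _ _ _ i.2 j.2 fun h => hij (Subtype.ext h)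
      have h1 := hNG _ _ (le_max_left i.1.1 j.1.1)
      have h2 := hNG _ _ (le_max_right i.1.1 j.1.1)
      omega)
    (fun i => by
      have h1 := hA _ _ i.2
      have h2 := hNG _ _ (le_refl i.1.1)
      rw [Nat.abs_cast]
      exact Or.inr (by omega))
    (fun S => by
      -- A label `l ≥ S` causes no exception since its centres are beyond `G l`.
      set s := ⌈S⌉₊ with hs
      have hfin : (Set.Iio s ×ˢ Set.Iio (G s)).Finite :=
        (Set.finite_Iio s).prod (Set.finite_Iio (G s))
      refine (hfin.preimage (Subtype.val_injective.injOn)).subset fun i hi => ?_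
      by_contra hcon
      refine hi fun z hz => ?_
      have h1 : g i.1.1 s ≤ i.1.2 := by
        rcases lt_or_ge i.1.1 s with h | h
        · refine (hgG _ _ s h.le le_rfl).trans ?_
          by_contra h'
          exact hcon ⟨h, not_le.1 h'⟩
        · exact (hgG _ _ _ le_rfl h).trans (hA _ _ i.2)
      have := hg i.1.1 s (-(i.1.2 : ℤ)) (by rw [abs_neg, Nat.abs_cast]; omega) z
        (hz.trans ((Nat.le_ceil S).trans (le_max_left _ _)))
      push_cast at this ⊢
      rw [← sub_eq_add_neg, neg_sq] at this
      exact this.trans (by gcongr; exact min_le_left _ _))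
  refine ⟨F, fun U hU hUne => ?_⟩
  obtain ⟨x, hx⟩ := hUne
  obtain ⟨_, ⟨l, rfl⟩, -, hlU⟩ := hb.exists_subset_of_mem_open hx hU
  have hvisit : A l ⊆ {n | evalMulTranslate^[n] F ∈ U} := by
    intro n hn
    refine hlU (hV l _ fun z hz => ?_)
    rw [hF ⟨(l, n), hn⟩ n rfl z]
    refine hF' ⟨(l, n), hn⟩ (δ l) z (hδ l).le fun j hj => ?_
    have h1 := hAsep _ _ _ _ hn j.2 fun h => hj (Subtype.ext h.symm)
    have h2 := hgG _ _ _ (le_max_right l j.1.1) (le_max_left l j.1.1)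
    refine (hg j.1.1 l _ ((Int.ofNat_le.2 h2).trans h1) z (hz.trans (le_max_right _ _))).trans ?_
    gcongr
    exact min_le_right _ _
  obtain ⟨κ, hκ, hd⟩ := hAd l
  refine .of_eventually_le hκ (hd.mono fun n hn => hn.trans ?_)
  have hfin : {m ∈ {k | evalMulTranslate^[k] F ∈ U} | m ≤ n}.Finite :=
    (Set.finite_Iic n).subset fun m hm => hm.2
  have hsub : {m ∈ A l | m ≤ n} ⊆ {m ∈ {k | evalMulTranslate^[k] F ∈ U} | m ≤ n} :=
    fun m hm => ⟨hvisit hm.1, hm.2⟩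
  exact_mod_cast Set.ncard_le_ncard hsub hfin

theorem IsFrequentlyHypercyclic.isHypercyclic {X : Type*} [TopologicalSpace X] {T : X → X}
    (h : IsFrequentlyHypercyclic T) : IsHypercyclic T := by
  obtain ⟨x, hx⟩ := h
  refine ⟨x, dense_iff_inter_open.2 fun U hU hUne => ?_⟩
  obtain ⟨n, hn⟩ := (hx U hU hUne).nonempty
  exact ⟨_, hn, n, rfl⟩

theorem theorem1 :
    IsHomogeneousPolynomial 2 evalMulTranslate ∧
      IsMixing evalMulTranslate ∧
      IsChaotic evalMulTranslate ∧
      IsFrequentlyHypercyclic evalMulTranslate :=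
  ⟨isHomogeneousPolynomial_evalMulTranslate, isMixing_evalMulTranslate,
    ⟨isFrequentlyHypercyclic_evalMulTranslate.isHypercyclic, dense_periodicPts_evalMulTranslate⟩,
    isFrequentlyHypercyclic_evalMulTranslate⟩
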